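/- Let $\mathcal H$ be a complex Hilbert space and let $(K,D(K))$ be a maximal accretive operator in $\mathcal H$, that is, a densely defined operator with $\mathrm{Re}\,\langle u,Ku\rangle\ge 0$ for all $u\in D(K)$ and such that $1+K:D(K)\to\mathcal H$ is a bijection. For a self-adjoint operator $(\Lambda,D(\Lambda))$ with $\Lambda\ge 1$ and $r\in(0,1]$, the operator $K$ is called $(\Lambda,r)$-cuspidal if $D(\Lambda)\subset D(K)$, $D(\Lambda)$ is dense in $D(K)$ for the graph norm, and there is a constant $C>0$ such that $$\|Ku\|\le C\|\Lambda u\|\quad\text{and}\quad \|\Lambda^{r}u\|\le C\big[\|(K-i\lambda)u\|+\|u\|\big]\qquad\text{for all }u\in D(\Lambda),\ \lambda\in\mathbb R.$$ For $r\in(0,1]$, the operator $K$ is called $r$-pseudospectral if there is a constant $C_K>0$ such that, for every $\lambda\in\mathbb R$, $-1+i\lambda$ is in the resolvent set of $K$ and $$\|(-1+i\lambda-K)^{-1}\|\le C_K\langle\lambda\rangle^{-r},\qquad \langle\lambda\rangle=(1+\lambda^2)^{1/2}.$$ Let $|1+K|=\sqrt{(1+K)^*(1+K)}$, where $(1+K)^*(1+K)$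 has domain $\{u\in D(K):(1+K)u\in D((1+K)^*)\}$. Then, for every $r\in(0,1]$: 1. if $K$ is $(\Lambda,r)$-cuspidal for some self-adjoint $\Lambda\ge 1$, then $K$ is $r$-pseudospectral; 2. if $K$ is $r$-pseudospectral, then $|1+K|$ is self-adjoint with $|1+K|\ge 1$, and $K$ is $(|1+K|,r')$-cuspidal for every $r'$ with $0<r'<\frac{r}{2-r}$. -/

import Mathlib

noncomputable section

namespace Cuspidal

variable {H : Type*} [NormedAddCommGroup H] [InnerProductSpace ℂ H] [CompleteSpace H]

/-- `z + K` as an unbounded operator, with domain `D(K)`. -/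
def shift (z : ℂ) (K : H →ₗ.[ℂ] H) : H →ₗ.[ℂ] H :=
  (z • (LinearMap.id : H →ₗ[ℂ] H)) +ᵥ K

/-- `R` is the everywhere defined bounded inverse of the unbounded operator `A`: it maps `H` into
`D(A)`, with `A R v = v` for all `v ∈ H` and `R A u = u` for all `u ∈ D(A)`. -/
def IsBoundedInverse (A : H →ₗ.[ℂ] H) (R : H →L[ℂ] H) : Prop :=
  (∀ v : H, ∃ u : A.domain, (u : H) = R v ∧ A u = v) ∧ ∀ u : A.domain, R (A u) = u

open Classical in
/-- The (unique) bounded inverse of `A` when there is one, and `0` otherwise. -/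
def boundedInverse (A : H →ₗ.[ℂ] H) : H →L[ℂ] H :=
  if h : ∃ R : H →L[ℂ] H, IsBoundedInverse A R then h.choose else 0

/-- The composition `B ∘ A` of unbounded operators, with its natural domain
`{u ∈ D(A) | A u ∈ D(B)}`. -/
def comp (B A : H →ₗ.[ℂ] H) : H →ₗ.[ℂ] H where
  domain := (B.domain.comap A.toFun).map A.domain.subtype
  toFun := B.toFun ∘ₗ
    (A.toFun.restrict (p := B.domain.comap A.toFun) (q := B.domain) fun _ h => h) ∘ₗ
    (A.domain.equivSubtypeMap (B.domain.comap A.toFun)).symm.toLinearMap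

/-- The operator inequality `Λ ≥ 1` for an unbounded operator: `⟨u, Λ u⟩ ≥ ‖u‖²` on `D(Λ)`. -/
def OneLE (Λ : H →ₗ.[ℂ] H) : Prop :=
  ∀ u : Λ.domain, ‖(u : H)‖ ^ 2 ≤ (inner ℂ (u : H) (Λ u)).re

/-- The fractional power `Λ ^ s`, `s > 0`, of a self-adjoint operator `Λ ≥ 1`. The operator `Λ⁻¹`
is bounded, self-adjoint, with `0 ≤ Λ⁻¹ ≤ 1`, and injective; `(Λ⁻¹) ^ s` is given by the
continuous functional calculus (it is again injective), and `Λ ^ s` is the inverse of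
`(Λ⁻¹) ^ s`, with domain the range of `(Λ⁻¹) ^ s`. -/
def fracPow (Λ : H →ₗ.[ℂ] H) (s : ℝ) : H →ₗ.[ℂ] H :=
  (LinearMap.toPMap (boundedInverse Λ ^ s : H →L[ℂ] H).toLinearMap ⊤).inverse

/-- The modulus `|A| = √(A* A)` of a closed densely defined operator `A` such that `A* A ≥ 1`. -/
def modulus (A : H →ₗ.[ℂ] H) : H →ₗ.[ℂ] H :=
  fracPow (comp A.adjoint A) (1 / 2)

/-- `K` is maximal accretive: densely defined, accretive, and `1 + K : D(K) → H` is bijective. -/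
structure IsMaximalAccretive (K : H →ₗ.[ℂ] H) : Prop where
  dense_domain : Dense (K.domain : Set H)
  accretive : ∀ u : K.domain, 0 ≤ (inner ℂ (u : H) (K u)).re
  bijective : Function.Bijective fun u : K.domain => (u : H) + K u

/-- `K` is `(Λ, r)`-cuspidal, where `Λ ≥ 1` is self-adjoint and `0 < r ≤ 1`. -/
structure IsCuspidal (K Λ : H →ₗ.[ℂ] H) (r : ℝ) : Prop where
  selfAdjoint : IsSelfAdjoint Λ
  one_le : OneLE Λ
  exponent_pos : 0 < r
  exponent_le_one : r ≤ 1
  domain_le : Λ.domain ≤ K.domain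
  /-- `D(Λ)` is dense in `D(K)` for the graph norm of `K`. -/
  dense : ∀ u : K.domain, ∀ ε > 0, ∃ v : K.domain, (v : H) ∈ Λ.domain ∧
    ‖(u : H) - v‖ < ε ∧ ‖K u - K v‖ < ε
  /-- The two estimates, for `u ∈ D(Λ)`; here `w` is `u` as an element of `D(Λ ^ r) ⊇ D(Λ)`. -/
  estimates : ∃ C : ℝ, 0 < C ∧
    (∀ u : Λ.domain, ‖K ⟨u, domain_le u.2⟩‖ ≤ C * ‖Λ u‖) ∧
    ∀ u : Λ.domain, ∃ w : (fracPow Λ r).domain, (w : H) = u ∧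
      ∀ t : ℝ, ‖fracPow Λ r w‖ ≤
        C * (‖K ⟨u, domain_le u.2⟩ - (Complex.I * t) • (u : H)‖ + ‖(u : H)‖)

/-- `K` is `r`-pseudospectral, where `0 < r ≤ 1`: for some `C > 0` and every real `t`, the operator
`-1 + i t - K` has a bounded inverse, of norm at most `C ⟨t⟩ ^ (-r)` with `⟨t⟩ = (1 + t²) ^ (1/2)`. -/
structure IsPseudospectral (K : H →ₗ.[ℂ] H) (r : ℝ) : Prop where
  exponent_pos : 0 < r
  exponent_le_one : r ≤ 1
  estimate : ∃ C : ℝ, 0 < C ∧ ∀ t : ℝ, ∃ R : H →L[ℂ] H,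
    IsBoundedInverse (shift (-1 + Complex.I * t) (-K)) R ∧ ‖R‖ ≤ C * √(1 + t ^ 2) ^ (-r)

end Cuspidal

end

open scoped NNReal InnerProductSpace

namespace Cuspidal

section Operators

variable {H : Type*} [NormedAddCommGroup H] [InnerProductSpace ℂ H]

/-! ### Bounded inverses of unbounded operators -/

namespace IsBoundedInverse

variable {A : H →ₗ.[ℂ] H} {R S : H →L[ℂ] H}

/-! Everything is done with bounded inverses. Put `T = Λ⁻¹`, `s = ⟨t⟩ = |1 - it|`, `f = (1 - it + K)
u`. Both directions cut a power of `T` at spectral height `1/s` (`exists_rpow_eq_add_mul`): `T ^ ρ =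
P + T G = P + G T` with `‖P‖ ≤ s ^ (-ρ)`, `‖G‖ ≤ s ^ (1 - ρ)`.

Cuspidal to pseudospectral: `W = Λ ^ r u` is `O(‖f‖)`, so `u = T ^ r W = T G W + P W`, where `K`
costs at most `s ^ (1 - r)` on the first piece and the second is `O(s ^ (-r))`. The resolvent `(s +
K)⁻¹`, of norm at most `1/s`, turns this splitting into `‖u‖ ≲ s ^ (-r) ‖f‖` (`norm_le_of_eq_add`).

Pseudospectral to cuspidal: for `Λ = |1 + K|` one has `D(Λ) = D(K)` and `‖Λ u‖ = ‖(1 + K) u‖`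
(`exists_modulus`). The resolvent bound gives `‖u‖ ≲ s ^ (-r) ‖f‖`, hence `‖Λ u‖ ≲ s ^ (1 - r) ‖f‖`.
Splitting `Λ ^ r' u = T ^ (1 - r') Λ u` interpolates these to `s ^ (r' - r) ‖f‖`, which is bounded
as soon as `r' ≤ r`. -/

lemma unique (hR : IsBoundedInverse A R) (hS : IsBoundedInverse A S) : R = S := by
  ext v
  obtain ⟨u, hu, rfl⟩ := hS.1 v
  rw [hR.2, hS.2]

lemma boundedInverse_eq (hR : IsBoundedInverse A R) : boundedInverse A = R := by
  have h : ∃ R : H →L[ℂ] H, IsBoundedInverse A R := ⟨R, hR⟩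
  rw [boundedInverse, dif_pos h]
  exact h.choose_spec.unique hR

lemma mem_domain (hR : IsBoundedInverse A R) (v : H) : R v ∈ A.domain := by
  obtain ⟨u, hu, -⟩ := hR.1 v
  exact hu ▸ u.2

lemma apply_mk (hR : IsBoundedInverse A R) (v : H) (h : R v ∈ A.domain) : A ⟨R v, h⟩ = v := by
  obtain ⟨u, hu, huv⟩ := hR.1 v
  have : u = ⟨R v, h⟩ := Subtype.ext hu
  rw [← this, huv]

lemma injective (hR : IsBoundedInverse A R) : Function.Injective R := fun v w h => by
  rw [← hR.apply_mk v (hR.mem_domain v), ← hR.apply_mk w (hR.mem_domain w)]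
  simp only [h]

variable [CompleteSpace H] in
/-- An operator with a bounded self-adjoint inverse is self-adjoint. -/
lemma isSelfAdjoint (hR : IsBoundedInverse A R) (hsa : IsSelfAdjoint R)
    (hd : Dense (A.domain : Set H)) : IsSelfAdjoint A := by
  have hsymm : ∀ x y : H, ⟪R x, y⟫_ℂ = ⟪x, R y⟫_ℂ := hsa.isSymmetric
  have hformal : A.IsFormalAdjoint A := fun x y => by
    conv_lhs => rw [← hR.2 y]
    conv_rhs => rw [← hR.2 x]
    exact (hsymm _ _).symm
  refine (LinearPMap.eq_of_le_of_domain_eq (hformal.le_adjoint hd)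
    (le_antisymm (hformal.le_adjoint hd).1 fun y hy => ?_)).symm
  have : y = R (A.adjoint ⟨y, hy⟩) := by
    refine ext_inner_right ℂ fun v => ?_
    obtain ⟨u, hu, rfl⟩ := hR.1 v
    rw [hsymm, ← hu, LinearPMap.adjoint_isFormalAdjoint hd ⟨y, hy⟩ u]
  rw [this]
  exact hR.mem_domain _

end IsBoundedInverse

/-- A surjective operator which is bounded below has a bounded inverse. -/
lemma exists_isBoundedInverse {A : H →ₗ.[ℂ] H} {c : ℝ} (hc : 0 ≤ c)
    (hsurj : ∀ v, ∃ u : A.domain, A u = v) (hA : ∀ u : A.domain, ‖(u : H)‖ ≤ c * ‖A u‖) :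
    ∃ R : H →L[ℂ] H, IsBoundedInverse A R ∧ ‖R‖ ≤ c := by
  have hinj : Function.Injective A.toFun := by
    rw [← LinearMap.ker_eq_bot, LinearMap.ker_eq_bot']
    intro u hu
    have hu' : A u = 0 := hu
    have := hA u
    rw [hu', norm_zero, mul_zero] at this
    exact Subtype.ext (norm_le_zero_iff.mp this)
  let e := LinearEquiv.ofBijective A.toFun ⟨hinj, hsurj⟩
  have he : ∀ v, A (e.symm v) = v := fun v => e.apply_symm_apply v
  refine ⟨(A.domain.subtype ∘ₗ e.symm.toLinearMap).mkContinuous c fun v => ?_,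
    ⟨fun v => ⟨e.symm v, rfl, he v⟩, fun u => ?_⟩,
    LinearMap.mkContinuous_norm_le _ hc _⟩
  · have := hA (e.symm v)
    rwa [he] at this
  · exact congrArg Subtype.val (e.symm_apply_apply u)

/-- The inverse of an injective bounded operator `R` has bounded inverse `R`. -/
lemma isBoundedInverse_inverse {R : H →L[ℂ] H} (hR : Function.Injective R) :
    IsBoundedInverse (LinearMap.toPMap R.toLinearMap ⊤).inverse R := by
  set f := LinearMap.toPMap R.toLinearMap ⊤ with hf
  have hker : f.toFun.ker = ⊥ := by
    rw [LinearMap.ker_eq_bot']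
    intro x hx
    have hx' : R x = R 0 := hx.trans (map_zero R).symm
    exact Subtype.ext (hR hx')
  have hmem : ∀ v, R v ∈ f.inverse.domain := fun v => by
    rw [LinearPMap.inverse_domain]
    exact ⟨⟨v, trivial⟩, rfl⟩
  have hval : ∀ v, f.inverse ⟨R v, hmem v⟩ = v := fun v =>
    LinearPMap.inverse_apply_eq hker (x := ⟨v, trivial⟩) rfl
  refine ⟨fun v => ⟨⟨R v, hmem v⟩, rfl, hval v⟩, fun ⟨u, hu⟩ => ?_⟩
  have hu' := hu
  rw [LinearPMap.inverse_domain] at hu'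
  obtain ⟨⟨v, hv⟩, rfl⟩ := hu'
  exact congrArg R (hval v)

variable [CompleteSpace H]

/-- A self-adjoint operator `Λ ≥ 1` has a bounded nonnegative inverse. -/
lemma exists_isBoundedInverse_of_oneLE {Λ : H →ₗ.[ℂ] H} (hsa : IsSelfAdjoint Λ) (h1 : OneLE Λ) :
    ∃ T : H →L[ℂ] H, IsBoundedInverse Λ T ∧ 0 ≤ T := by
  have hd := hsa.dense_domain
  have hsa' : Λ.adjoint = Λ := hsa
  have hbelow : ∀ u : Λ.domain, ‖(u : H)‖ ≤ 1 * ‖Λ u‖ := fun u => by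
    have h := (h1 u).trans (re_inner_le_norm (𝕜 := ℂ) (u : H) (Λ u))
    rcases (norm_nonneg (u : H)).eq_or_lt with h0 | h0
    · rw [← h0]; positivity
    · nlinarith
  have hinj : Function.Injective Λ.toFun := by
    rw [← LinearMap.ker_eq_bot, LinearMap.ker_eq_bot']
    intro u hu
    have hu' : Λ u = 0 := hu
    have := hbelow u
    rw [hu', norm_zero, mul_zero] at this
    exact Subtype.ext (norm_le_zero_iff.mp this)
  -- The functional `Λ u ↦ ⟪v, u⟫` is bounded on the range. Hahn–Banach and Riesz represent it by
  -- some `w`, so `w ∈ D(Λ†) = D(Λ)` and `Λ w = v`.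
  have hsurj : ∀ v, ∃ u : Λ.domain, Λ u = v := fun v => by
    let e := LinearEquiv.ofInjective Λ.toFun hinj
    have he : ∀ y, Λ (e.symm y) = y := fun y => congrArg Subtype.val (e.apply_symm_apply y)
    let φ : StrongDual ℂ (LinearMap.range Λ.toFun) :=
      LinearMap.mkContinuous
        ((innerSL ℂ v).toLinearMap ∘ₗ Λ.domain.subtype ∘ₗ e.symm.toLinearMap) ‖v‖ fun y => by
          have h2 := hbelow (e.symm y)
          rw [he, one_mul] at h2
          exact (norm_inner_le_norm v (e.symm y : H)).trans (by gcongr; exact h2)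
    obtain ⟨g, hg, -⟩ := exists_extension_norm_eq (LinearMap.range Λ.toFun) φ
    let w := (InnerProductSpace.toDual ℂ H).symm g
    have hw : ∀ u : Λ.domain, ⟪v, (u : H)⟫_ℂ = ⟪w, Λ u⟫_ℂ := fun u => by
      have h2 : ⟪w, Λ u⟫_ℂ = g (Λ u) := InnerProductSpace.toDual_symm_apply
      have h3 : g (Λ u) = φ (e u) := hg (e u)
      rw [h2, h3]
      change _ = ⟪v, ((e.symm (e u) : Λ.domain) : H)⟫_ℂ
      rw [e.symm_apply_apply]
    have hmem : w ∈ Λ.adjoint.domain := LinearPMap.mem_adjoint_domain_of_exists w ⟨v, hw⟩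
    have hval := LinearPMap.adjoint_apply_eq hd ⟨w, hmem⟩ hw
    have key : ∀ B : H →ₗ.[ℂ] H, B = Λ → ∀ h : w ∈ B.domain, B ⟨w, h⟩ = v →
        ∃ u : Λ.domain, Λ u = v := by
      rintro B rfl h hB
      exact ⟨_, hB⟩
    exact key _ hsa' hmem hval
  obtain ⟨T, hT, -⟩ := exists_isBoundedInverse zero_le_one hsurj hbelow
  refine ⟨T, hT, ?_⟩
  have hformal : Λ.IsFormalAdjoint Λ := by
    have := LinearPMap.adjoint_isFormalAdjoint hd
    rwa [hsa'] at this
  rw [ContinuousLinearMap.nonneg_iff_isPositive]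
  refine ⟨fun x y => ?_, fun x => ?_⟩
  · obtain ⟨u, hu, rfl⟩ := hT.1 x
    obtain ⟨v, hv, rfl⟩ := hT.1 y
    have h := hformal u v
    rw [hu, hv] at h
    exact h.symm
  · obtain ⟨u, hu, rfl⟩ := hT.1 x
    change 0 ≤ RCLike.re ⟪T (Λ u), Λ u⟫_ℂ
    rw [← hu]
    exact (sq_nonneg _).trans (h1 u)

/-! ### Powers of a bounded nonnegative operator -/

lemma rpow_mul_rpow_one_sub {T : H →L[ℂ] H} (hT : 0 ≤ T) {s : ℝ} (h0 : 0 ≤ s) (h1 : s ≤ 1) :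
    T ^ s * T ^ (1 - s) = T := by
  rw [CFC.rpow_def, CFC.rpow_def, ← cfc_mul _ _ T
    (NNReal.continuous_rpow_const h0).continuousOn
    (NNReal.continuous_rpow_const (sub_nonneg.mpr h1)).continuousOn]
  conv_rhs => rw [← cfc_id ℝ≥0 T]
  refine cfc_congr fun x _ => ?_
  have := NNReal.rpow_add_of_nonneg x h0 (sub_nonneg.mpr h1)
  simp only [← this, add_sub_cancel, NNReal.rpow_one, id]

lemma injective_rpow {T : H →L[ℂ] H} (hT : 0 ≤ T) (hinj : Function.Injective T) {s : ℝ}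
    (h0 : 0 ≤ s) (h1 : s ≤ 1) : Function.Injective (T ^ s : H →L[ℂ] H) := by
  have h := rpow_mul_rpow_one_sub hT (sub_nonneg.mpr h1) (sub_le_self 1 h0)
  rw [sub_sub_cancel] at h
  intro x y hxy
  apply hinj
  rw [← h, mul_apply_eq_comp, mul_apply_eq_comp, hxy]

/-- Splitting of `T ^ ρ` at the spectral height `s⁻¹`, as in real interpolation. -/
lemma exists_rpow_eq_add_mul {T : H →L[ℂ] H} (hT : 0 ≤ T) {ρ s : ℝ} (h0 : 0 ≤ ρ) (h1 : ρ ≤ 1)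
    (hs : 0 < s) : ∃ P G : H →L[ℂ] H, T ^ ρ = P + T * G ∧ T ^ ρ = P + G * T ∧
      ‖P‖ ≤ s ^ (-ρ) ∧ ‖G‖ ≤ s ^ (1 - ρ) := by
  lift s to ℝ≥0 using hs.le
  have hs' : 0 < s := by exact_mod_cast hs
  -- A smooth cutoff: `x ^ ρ = p + x * (s * p)`, and `p ≤ s ^ (-ρ)` because `y ^ ρ ≤ 1 + y` at `y =
  -- s * x`.
  let p : ℝ≥0 → ℝ≥0 := fun x => x ^ ρ * (1 + s * x)⁻¹
  let g : ℝ≥0 → ℝ≥0 := fun x => s * p x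
  have hp : Continuous p := by
    refine (NNReal.continuous_rpow_const h0).mul (Continuous.inv₀ (by fun_prop) fun x => ?_)
    positivity
  have hg : Continuous g := continuous_const.mul hp
  have hpb : ∀ x, p x ≤ s ^ (-ρ) := fun x => by
    have hy : (s * x) ^ ρ ≤ 1 + s * x := by
      rcases le_total (s * x) 1 with h | h
      · exact (NNReal.rpow_le_one h h0).trans le_self_add
      · exact (NNReal.rpow_le_rpow_of_exponent_le h h1).trans (by simp)
    rw [NNReal.mul_rpow] at hy
    change x ^ ρ * (1 + s * x)⁻¹ ≤ s ^ (-ρ)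
    rw [NNReal.rpow_neg, ← div_eq_mul_inv, ← one_div,
      div_le_div_iff₀ (by positivity) (NNReal.rpow_pos hs'), one_mul, mul_comm]
    exact hy
  have hgb : ∀ x, g x ≤ s ^ (1 - ρ) := fun x => by
    rw [sub_eq_add_neg, NNReal.rpow_add hs'.ne', NNReal.rpow_one]
    exact mul_le_mul_right (hpb x) s
  have hsum : ∀ x : ℝ≥0, p x + x * g x = x ^ ρ := fun x => by
    have h : (1 + s * x) ≠ 0 := by positivity
    calc p x + x * g x = x ^ ρ * ((1 + s * x)⁻¹ * (1 + s * x)) := by simp only [g, p]; ring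
      _ = x ^ ρ := by rw [inv_mul_cancel₀ h, mul_one]
  have h_id_mul : cfc (fun x => x * g x) T = T * cfc g T := by
    rw [cfc_mul (fun x => x) g T continuousOn_id hg.continuousOn, cfc_id' ℝ≥0 T]
  have h_mul_id : cfc (fun x => g x * x) T = cfc g T * T := by
    rw [cfc_mul g (fun x => x) T hg.continuousOn continuousOn_id, cfc_id' ℝ≥0 T]
  refine ⟨cfc p T, cfc g T, ?_, ?_, ?_, ?_⟩
  · rw [← h_id_mul, ← cfc_add T p (fun x => x * g x) hp.continuousOn
      (continuous_id.mul hg).continuousOn, CFC.rpow_def]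
    exact cfc_congr fun x _ => (hsum x).symm
  · rw [← h_mul_id, ← cfc_add T p (fun x => g x * x) hp.continuousOn
      (hg.mul continuous_id).continuousOn, CFC.rpow_def]
    exact cfc_congr fun x _ => by simp only [mul_comm (g x), hsum]
  · have := nnnorm_cfc_nnreal_le (a := T) fun x _ => hpb x
    exact_mod_cast this
  · have := nnnorm_cfc_nnreal_le (a := T) fun x _ => hgb x
    exact_mod_cast this

lemma isBoundedInverse_fracPow {Λ : H →ₗ.[ℂ] H} {T : H →L[ℂ] H} (hΛ : IsBoundedInverse Λ T)
    (hT : 0 ≤ T) {s : ℝ} (h0 : 0 ≤ s) (h1 : s ≤ 1) :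
    IsBoundedInverse (fracPow Λ s) (T ^ s) := by
  rw [fracPow, hΛ.boundedInverse_eq]
  exact isBoundedInverse_inverse (injective_rpow hT hΛ.injective h0 h1)

/-- Douglas factorization: if `‖X v‖ ≤ ‖Y v‖` for all `v` and `Y` has dense range, then every
`X† w` is of the form `Y† w'` with `‖w'‖ ≤ ‖w‖`. -/
lemma exists_adjoint_apply_eq {X Y : H →L[ℂ] H} (hd : DenseRange Y) (h : ∀ v, ‖X v‖ ≤ ‖Y v‖)
    (w : H) : ∃ w', X.adjoint w = Y.adjoint w' ∧ ‖w'‖ ≤ ‖w‖ := by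
  have hb : ∀ v, ‖X.toLinearMap v‖ ≤ 1 * ‖Y.toLinearMap v‖ := fun v => by simpa using h v
  -- `V` extends the contraction `Y v ↦ X v`; thus `X = V Y`, `X† = Y† V†`, and `w' = V† w`.
  let V := X.toLinearMap.extendOfNorm Y.toLinearMap
  have hV : ∀ v, V (Y v) = X v := fun v => LinearMap.extendOfNorm_eq hd ⟨1, hb⟩ v
  have hn : ‖V‖ ≤ 1 := LinearMap.opNorm_extendOfNorm_le hd zero_le_one hb
  refine ⟨V.adjoint w, ext_inner_right ℂ fun v => ?_, ?_⟩
  · rw [ContinuousLinearMap.adjoint_inner_left, ContinuousLinearMap.adjoint_inner_left,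
      ContinuousLinearMap.adjoint_inner_left, hV]
  · refine (V.adjoint.le_opNorm w).trans ?_
    rw [LinearIsometryEquiv.norm_map]
    exact mul_le_of_le_one_left (norm_nonneg w) hn

lemma denseRange_of_injective_adjoint {X : H →L[ℂ] H} (h : Function.Injective X.adjoint) :
    DenseRange X := by
  have : X.range.topologicalClosure = ⊤ := by
    rw [Submodule.topologicalClosure_eq_top_iff, X.orthogonal_range]
    exact LinearMap.ker_eq_bot.mpr h
  exact Submodule.dense_iff_topologicalClosure_eq_top.mpr this

end Operators

section MaximalAccretive

variable {H : Type*} [NormedAddCommGroup H] [InnerProductSpace ℂ H]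

/-! ### Resolvents of maximal accretive operators -/

namespace IsMaximalAccretive

variable {K : H →ₗ.[ℂ] H} (hK : IsMaximalAccretive K)
include hK

/-- Pair `z u + K u` with `u`, drop the nonnegative term `Re ⟪u, K u⟫`, and apply Cauchy–Schwarz. -/
lemma re_mul_norm_le (z : ℂ) (u : K.domain) : z.re * ‖(u : H)‖ ≤ ‖z • (u : H) + K u‖ := by
  have h1 : z.re * ‖(u : H)‖ ^ 2 ≤ ‖(u : H)‖ * ‖z • (u : H) + K u‖ := by
    refine le_trans ?_ (re_inner_le_norm (𝕜 := ℂ) (u : H) (z • (u : H) + K u))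
    have h2 := hK.accretive u
    rw [inner_add_right, inner_smul_right, inner_self_eq_norm_sq_to_K]
    have h3 : (z * ((‖(u : H)‖ : ℂ)) ^ 2).re = z.re * ‖(u : H)‖ ^ 2 := by
      rw [← Complex.ofReal_pow, Complex.re_mul_ofReal]
    simp only [RCLike.re_to_complex, Complex.add_re, Complex.coe_algebraMap, h3]
    linarith
  rcases (norm_nonneg (u : H)).eq_or_lt with h0 | h0
  · rw [← h0, mul_zero]; positivity
  · nlinarith

lemma norm_le (z : ℂ) (hz : 1 ≤ z.re) (u : K.domain) : ‖(u : H)‖ ≤ ‖z • (u : H) + K u‖ :=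
  (le_mul_of_one_le_left (norm_nonneg _) hz).trans (hK.re_mul_norm_le z u)

/-- Neumann series: `w + K = (1 - (z - w) R) (z + K)` with `R = (z + K)⁻¹` a contraction. -/
lemma surjective_of_norm_sub_lt [CompleteSpace H] {z w : ℂ} (hz : 1 ≤ z.re)
    (hsurj : ∀ v, ∃ u : K.domain, z • (u : H) + K u = v) (hw : ‖w - z‖ < 1) (v : H) :
    ∃ u : K.domain, w • (u : H) + K u = v := by
  obtain ⟨R, hR, hn⟩ := exists_isBoundedInverse (A := shift z K) zero_le_one hsurj fun u => by
    rw [one_mul]; exact hK.norm_le z hz u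
  have hlt : ‖(z - w) • R‖ < 1 := by
    rw [norm_smul, norm_sub_rev]
    exact (mul_le_of_le_one_right (norm_nonneg _) hn).trans_lt hw
  obtain ⟨S, hS⟩ := (isUnit_one_sub_of_norm_lt_one hlt).exists_right_inv
  have hy : S v - (z - w) • R (S v) = v := by
    have := congrArg (fun X : H →L[ℂ] H => X v) hS
    simpa [mul_apply_eq_comp] using this
  obtain ⟨u, hu, hu'⟩ := hR.1 (S v)
  change z • (u : H) + K u = S v at hu'
  refine ⟨u, ?_⟩
  calc w • (u : H) + K u = (z • (u : H) + K u) - (z - w) • (u : H) := by module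
    _ = v := by rw [hu', hu, hy]

/-- Continuity method: go from `1` to `z` along the segment in `N` steps shorter than `1`, the
perturbation radius being uniform on `Re ≥ 1`. -/
lemma surjective [CompleteSpace H] {z : ℂ} (hz : 1 ≤ z.re) (v : H) :
    ∃ u : K.domain, z • (u : H) + K u = v := by
  obtain ⟨N, hN⟩ := exists_nat_gt ‖z - 1‖
  have hN0 : (0 : ℝ) < N := (norm_nonneg _).trans_lt hN
  let δ : ℂ := (z - 1) / N
  have hδ : ‖δ‖ < 1 := by
    rw [norm_div, Complex.norm_natCast, div_lt_one hN0]; exact hN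
  have hre : 0 ≤ δ.re := by
    rw [Complex.div_natCast_re]
    exact div_nonneg (by simpa using hz) hN0.le
  have key : ∀ n : ℕ, ∀ v, ∃ u : K.domain, (1 + n * δ) • (u : H) + K u = v := by
    intro n
    induction n with
    | zero =>
      intro v
      obtain ⟨u, hu⟩ := hK.bijective.2 v
      exact ⟨u, by simpa using hu⟩
    | succ n ih =>
      refine hK.surjective_of_norm_sub_lt (z := 1 + n * δ) ?_ ih ?_
      · have : (1 + n * δ : ℂ).re = 1 + n * δ.re := by simp
        rw [this]
        have : 0 ≤ n * δ.re := by positivity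
        linarith
      · rw [show (1 + ((n + 1 : ℕ) : ℂ) * δ - (1 + n * δ)) = δ by push_cast; ring]
        exact hδ
  have hz' : 1 + N * δ = z := by
    have : (N : ℂ) ≠ 0 := by exact_mod_cast hN0.ne'
    simp only [δ]
    rw [mul_div_cancel₀ _ this]
    ring
  rw [← hz']
  exact key N v

/-- The resolvent `(s + K)⁻¹` for `s ≥ 1`. -/
lemma exists_resolvent [CompleteSpace H] {s : ℝ} (hs : 1 ≤ s) :
    ∃ R : H →L[ℂ] H, IsBoundedInverse (shift (s : ℂ) K) R ∧ ‖R‖ ≤ s⁻¹ := by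
  refine exists_isBoundedInverse (by positivity) (hK.surjective (by simpa using hs)) fun u => ?_
  rw [← div_eq_inv_mul, le_div_iff₀' (by positivity)]
  exact hK.re_mul_norm_le s u

end IsMaximalAccretive

lemma norm_I_mul_sub_one (t : ℝ) : ‖Complex.I * t - 1‖ = √(1 + t ^ 2) := by
  rw [show Complex.I * t - 1 = ((-1 : ℝ) : ℂ) + t * Complex.I by push_cast; ring,
    Complex.norm_add_mul_I]
  norm_num

lemma one_le_sqrt_one_add_sq (t : ℝ) : 1 ≤ √(1 + t ^ 2) :=
  Real.one_le_sqrt.mpr (by nlinarith [sq_nonneg t])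

/-- If `u = a + b` with `K a` and `b` controlled, then `u` is controlled by `(1 - i t + K) u`. -/
lemma IsMaximalAccretive.norm_le_of_eq_add [CompleteSpace H] {K : H →ₗ.[ℂ] H}
    (hK : IsMaximalAccretive K) (t : ℝ) (u a : K.domain) (b : H) (hu : (u : H) = a + b) :
    ‖(u : H)‖ ≤ 2 * ((√(1 + t ^ 2))⁻¹ * ‖K a‖) + 4 * ‖b‖ +
      (√(1 + t ^ 2))⁻¹ * ‖(1 - Complex.I * t) • (u : H) + K u‖ := by
  set s := √(1 + t ^ 2) with hs
  have hs1 : 1 ≤ s := one_le_sqrt_one_add_sq t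
  have hs0 : 0 < s := by positivity
  set f := (1 - Complex.I * t) • (u : H) + K u with hf
  obtain ⟨R, hR, hn⟩ := hK.exists_resolvent hs1
  have hRK : ∀ x : K.domain, R (K x) = x - (s : ℂ) • R x := fun x => by
    have h : R ((s : ℂ) • (x : H) + K x) = x := hR.2 x
    rw [map_add, map_smul] at h
    exact eq_sub_of_add_eq' h
  have hRb : ∀ x : H, ‖R x‖ ≤ s⁻¹ * ‖x‖ := fun x =>
    (R.le_opNorm x).trans (mul_le_mul_of_nonneg_right hn (norm_nonneg x))
  have hsR : ∀ x : H, ‖(s : ℂ) • R x‖ ≤ ‖x‖ := fun x => by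
    rw [norm_smul, Complex.norm_real, Real.norm_of_nonneg hs0.le]
    calc s * ‖R x‖ ≤ s * (s⁻¹ * ‖x‖) := by gcongr; exact hRb x
      _ = ‖x‖ := by field_simp
  -- `p = R K u`: apply `R K` to `a`, but use `R K = 1 - s R` on `b`, which need not be handled
  -- through `K b`.
  set p := (u : H) - (s : ℂ) • R u with hp
  have hpn : ‖p‖ ≤ s⁻¹ * ‖K a‖ + 2 * ‖b‖ := by
    have h1 : p = R (K a) + (b - (s : ℂ) • R b) := by
      rw [hRK, hp, hu, map_add]; module
    rw [h1]
    refine (norm_add_le _ _).trans (add_le_add (hRb _) ?_)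
    linarith [norm_sub_le b ((s : ℂ) • R b), hsR b]
  -- As `|it - 1| = s`, this controls `s R u`, the remaining part of `u = p + s R u`.
  have h2 : (Complex.I * t - 1) • R u = p - R f := by
    rw [hp, hf, map_add, map_smul, hRK]; module
  have h3 : ‖(s : ℂ) • R u‖ ≤ ‖p‖ + s⁻¹ * ‖f‖ := by
    rw [norm_smul, Complex.norm_real, Real.norm_of_nonneg hs0.le]
    have h4 := congrArg norm h2
    rw [norm_smul, norm_I_mul_sub_one, ← hs] at h4
    rw [h4]
    linarith [norm_sub_le p (R f), hRb f]
  have h5 : (u : H) = p + (s : ℂ) • R u := by rw [hp]; abel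
  calc ‖(u : H)‖ = ‖p + (s : ℂ) • R u‖ := by rw [← h5]
    _ ≤ _ := by linarith [norm_add_le p ((s : ℂ) • R u)]

lemma IsPseudospectral.norm_le {K : H →ₗ.[ℂ] H} {r : ℝ} (h : IsPseudospectral K r) :
    ∃ C : ℝ, 0 < C ∧ ∀ (t : ℝ) (u : K.domain),
      ‖(u : H)‖ ≤ C * √(1 + t ^ 2) ^ (-r) * ‖(1 - Complex.I * t) • (u : H) + K u‖ := by
  obtain ⟨C, hC, hR⟩ := h.estimate
  refine ⟨C, hC, fun t u => ?_⟩
  obtain ⟨R, hR, hn⟩ := hR t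
  have h1 : shift (-1 + Complex.I * t) (-K) u =
      -((1 - Complex.I * t) • (u : H) + K u) := by
    change (-1 + Complex.I * t) • (u : H) + -K u = _
    module
  have h2 : R (shift (-1 + Complex.I * t) (-K) u) = u := hR.2 u
  rw [h1] at h2
  calc ‖(u : H)‖ = ‖R (-((1 - Complex.I * t) • (u : H) + K u))‖ := by rw [h2]
    _ ≤ ‖R‖ * ‖-((1 - Complex.I * t) • (u : H) + K u)‖ := R.le_opNorm _
    _ ≤ _ := by rw [norm_neg]; gcongr

variable [CompleteSpace H]

/-! ### Cuspidal operators are pseudospectral -/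

lemma IsCuspidal.norm_le_of_mem {K Λ : H →ₗ.[ℂ] H} {r : ℝ} (hK : IsMaximalAccretive K)
    (h : IsCuspidal K Λ r) : ∃ M : ℝ, 0 < M ∧ ∀ (t : ℝ) (u : K.domain), (u : H) ∈ Λ.domain →
      ‖(u : H)‖ ≤ M * √(1 + t ^ 2) ^ (-r) * ‖(1 - Complex.I * t) • (u : H) + K u‖ := by
  obtain ⟨T, hΛ, hT⟩ := exists_isBoundedInverse_of_oneLE h.selfAdjoint h.one_le
  have hpow := isBoundedInverse_fracPow hΛ hT h.exponent_pos.le h.exponent_le_one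
  obtain ⟨C, hC, hC1, hC2⟩ := h.estimates
  -- This is `(2C + 4) * 3C + 1`, with `‖W‖ ≤ 3C ‖f‖` below.
  refine ⟨6 * C ^ 2 + 12 * C + 1, by positivity, fun t u hu => ?_⟩
  set s := √(1 + t ^ 2) with hs
  have hs1 : 1 ≤ s := one_le_sqrt_one_add_sq t
  have hs0 : 0 < s := by positivity
  set f := (1 - Complex.I * t) • (u : H) + K u with hf
  obtain ⟨w, hwu, hw⟩ := hC2 ⟨u, hu⟩
  set W := fracPow Λ r w with hW
  have hW1 : ‖W‖ ≤ 3 * C * ‖f‖ := by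
    have huf : ‖(u : H)‖ ≤ ‖f‖ := hK.norm_le _ (by simp) u
    have h1 : K u - (Complex.I * t) • (u : H) = f - u := by rw [hf]; module
    have h2 : ‖W‖ ≤ C * (‖K u - (Complex.I * t) • (u : H)‖ + ‖(u : H)‖) := hw t
    rw [h1] at h2
    calc ‖W‖ ≤ C * (‖f - u‖ + ‖(u : H)‖) := h2
      _ ≤ C * (3 * ‖f‖) := by gcongr; linarith [norm_sub_le f u]
      _ = 3 * C * ‖f‖ := by ring
  have hTW : (T ^ r : H →L[ℂ] H) W = u := (hpow.2 w).trans hwu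
  obtain ⟨P, G, hPG, -, hP, hG⟩ :=
    exists_rpow_eq_add_mul hT h.exponent_pos.le h.exponent_le_one hs0
  have ha : T (G W) ∈ Λ.domain := hΛ.mem_domain _
  have hdecomp : (u : H) = T (G W) + P W := by
    rw [← hTW, hPG, add_comm]; rfl
  have hKa : ‖K ⟨T (G W), h.domain_le ha⟩‖ ≤ C * (s ^ (1 - r) * ‖W‖) := by
    refine (hC1 ⟨_, ha⟩).trans ?_
    rw [hΛ.apply_mk]
    gcongr
    exact (G.le_opNorm W).trans (by gcongr)
  have hPW : ‖P W‖ ≤ s ^ (-r) * ‖W‖ := (P.le_opNorm W).trans (by gcongr)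
  have hsr : s⁻¹ * s ^ (1 - r) = s ^ (-r) := by
    rw [sub_eq_add_neg, Real.rpow_add hs0, Real.rpow_one, inv_mul_cancel_left₀ hs0.ne']
  have hsinv : s⁻¹ ≤ s ^ (-r) := by
    rw [← Real.rpow_neg_one]
    exact Real.rpow_le_rpow_of_exponent_le hs1 (neg_le_neg h.exponent_le_one)
  have hsp : 0 ≤ s ^ (-r) := by positivity
  calc ‖(u : H)‖ ≤ 2 * (s⁻¹ * ‖K ⟨T (G W), h.domain_le ha⟩‖) + 4 * ‖P W‖ + s⁻¹ * ‖f‖ :=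
        hK.norm_le_of_eq_add t u ⟨T (G W), h.domain_le ha⟩ (P W) hdecomp
    _ ≤ 2 * (s⁻¹ * (C * (s ^ (1 - r) * ‖W‖))) + 4 * (s ^ (-r) * ‖W‖) + s ^ (-r) * ‖f‖ := by
        gcongr
    _ = s ^ (-r) * ((2 * C + 4) * ‖W‖ + ‖f‖) := by rw [← hsr]; ring
    _ ≤ s ^ (-r) * ((2 * C + 4) * (3 * C * ‖f‖) + ‖f‖) := by gcongr
    _ = (6 * C ^ 2 + 12 * C + 1) * s ^ (-r) * ‖f‖ := by ring

/-- Maximal accretivity gives surjectivity; the estimate on `D(Λ)` passes to `D(K)` by graph-norm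
density. -/
theorem IsCuspidal.isPseudospectral {K Λ : H →ₗ.[ℂ] H} {r : ℝ} (hK : IsMaximalAccretive K)
    (h : IsCuspidal K Λ r) : IsPseudospectral K r := by
  obtain ⟨M, hM, hMu⟩ := h.norm_le_of_mem hK
  refine ⟨h.exponent_pos, h.exponent_le_one, M, hM, fun t => ?_⟩
  set c := M * √(1 + t ^ 2) ^ (-r) with hc
  have hc0 : 0 < c := by
    have := one_le_sqrt_one_add_sq t
    positivity
  have hA : ∀ u : K.domain, shift (-1 + Complex.I * t) (-K) u =
      -((1 - Complex.I * t) • (u : H) + K u) := fun u => by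
    change (-1 + Complex.I * t) • (u : H) + -K u = _
    module
  refine exists_isBoundedInverse hc0.le (fun v => ?_) fun (u : K.domain) => ?_
  · obtain ⟨u, hu⟩ := hK.surjective (z := 1 - Complex.I * t) (by simp) (-v)
    exact ⟨u, by rw [hA u, hu, neg_neg]⟩
  · rw [hA u, norm_neg]
    refine le_of_forall_pos_le_add fun η hη => ?_
    set S := ‖(1 - Complex.I * t : ℂ)‖
    have hS : 0 < 1 + c * (S + 1) := by positivity
    -- Chosen so that the total error `ε + c (S ε + ε)` equals `η`.
    obtain ⟨v, hv, hv1, hv2⟩ := h.dense u (η / (1 + c * (S + 1))) (by positivity)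
    set ε := η / (1 + c * (S + 1)) with hε
    have h1 : ‖(1 - Complex.I * t) • (v : H) + K v‖ ≤
        ‖(1 - Complex.I * t) • (u : H) + K u‖ + (S * ε + ε) := by
      have h2 : (1 - Complex.I * t) • (v : H) + K v = ((1 - Complex.I * t) • (u : H) + K u) -
          ((1 - Complex.I * t) • ((u : H) - v) + (K u - K v)) := by module
      rw [h2]
      refine (norm_sub_le _ _).trans (add_le_add le_rfl ((norm_add_le _ _).trans ?_))
      rw [norm_smul]
      gcongr
    calc ‖(u : H)‖ = ‖((u : H) - v) + v‖ := by rw [sub_add_cancel]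
      _ ≤ ε + c * (‖(1 - Complex.I * t) • (u : H) + K u‖ + (S * ε + ε)) :=
          (norm_add_le _ _).trans
            (add_le_add hv1.le ((hMu t v hv).trans (mul_le_mul_of_nonneg_left h1 hc0.le)))
      _ = c * ‖(1 - Complex.I * t) • (u : H) + K u‖ + ε * (1 + c * (S + 1)) := by ring
      _ = _ := by rw [hε, div_mul_cancel₀ _ hS.ne']

end MaximalAccretive

section Modulus

variable {H : Type*} [NormedAddCommGroup H] [InnerProductSpace ℂ H]

/-! ### The modulus of an operator with a bounded inverse -/

lemma mem_comp_domain {B A : H →ₗ.[ℂ] H} {x : H} :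
    x ∈ (comp B A).domain ↔ ∃ h : x ∈ A.domain, A ⟨x, h⟩ ∈ B.domain := by
  constructor
  · rintro ⟨u, hu, rfl⟩
    exact ⟨u.2, hu⟩
  · rintro ⟨h, hu⟩
    exact ⟨⟨x, h⟩, hu, rfl⟩

lemma comp_apply {B A : H →ₗ.[ℂ] H} (x : (comp B A).domain) (h : (x : H) ∈ A.domain)
    (h' : A ⟨x, h⟩ ∈ B.domain) : comp B A x = B ⟨A ⟨x, h⟩, h'⟩ := by
  obtain ⟨y, hy⟩ := (A.domain.equivSubtypeMap (B.domain.comap A.toFun)).surjective x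
  subst hy
  change B.toFun _ = B.toFun _
  simp only [LinearMap.comp_apply, LinearEquiv.coe_coe, LinearEquiv.symm_apply_apply]
  rfl

variable [CompleteSpace H]

/-- If `B` is the bounded inverse of `A`, then `B B†` is the bounded inverse of `A† A`. -/
lemma IsBoundedInverse.adjoint_comp_self {A : H →ₗ.[ℂ] H} {B : H →L[ℂ] H}
    (hB : IsBoundedInverse A B) (hd : Dense (A.domain : Set H)) :
    IsBoundedInverse (comp A.adjoint A) (B * B.adjoint) := by
  have hadj : ∀ v (x : A.domain), ⟪v, (x : H)⟫_ℂ = ⟪B.adjoint v, A x⟫_ℂ := fun v x => by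
    rw [ContinuousLinearMap.adjoint_inner_left, hB.2]
  have hmem : ∀ v, B.adjoint v ∈ A.adjoint.domain := fun v =>
    LinearPMap.mem_adjoint_domain_of_exists _ ⟨v, hadj v⟩
  refine ⟨fun v => ?_, fun u => ?_⟩
  · have h1 : B (B.adjoint v) ∈ A.domain := hB.mem_domain _
    have h2 : A ⟨B (B.adjoint v), h1⟩ = B.adjoint v := hB.apply_mk _ h1
    have h3 : A ⟨B (B.adjoint v), h1⟩ ∈ A.adjoint.domain := by
      rw [h2]; exact hmem v
    refine ⟨⟨B (B.adjoint v), mem_comp_domain.mpr ⟨h1, h3⟩⟩, rfl, ?_⟩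
    rw [comp_apply _ h1 h3]
    exact LinearPMap.adjoint_apply_eq hd _ fun x => by
      simp only [h2]
      exact hadj v x
  · obtain ⟨h1, h3⟩ := mem_comp_domain.mp u.2
    rw [comp_apply u h1 h3, mul_apply_eq_comp]
    have h4 : B.adjoint (A.adjoint ⟨A ⟨u, h1⟩, h3⟩) = A ⟨u, h1⟩ := by
      refine ext_inner_right ℂ fun v => ?_
      obtain ⟨x, hx, rfl⟩ := hB.1 v
      rw [ContinuousLinearMap.adjoint_inner_left, ← hx,
        LinearPMap.adjoint_isFormalAdjoint hd ⟨A ⟨u, h1⟩, h3⟩ x]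
    rw [h4, hB.2]

/-- The inverse `T = (B B†) ^ (1/2)` of the modulus `|A|`, where `B = A⁻¹` is a contraction: the
range of `T` is the domain of `A`, and `‖A u‖ = ‖|A| u‖`. -/
lemma IsBoundedInverse.exists_modulus {A : H →ₗ.[ℂ] H} {B : H →L[ℂ] H}
    (hB : IsBoundedInverse A B) (hd : Dense (A.domain : Set H)) (hB1 : ‖B‖ ≤ 1) :
    ∃ T : H →L[ℂ] H, IsBoundedInverse (modulus A) T ∧ 0 ≤ T ∧ ‖T‖ ≤ 1 ∧
      (∀ v, ∃ h : T v ∈ A.domain, ‖A ⟨T v, h⟩‖ = ‖v‖) ∧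
      ∀ u : A.domain, ∃ v, T v = u := by
  have hBB := hB.adjoint_comp_self hd
  have hpos : 0 ≤ B * B.adjoint := mul_star_self_nonneg B
  have hT0 : 0 ≤ ((B * B.adjoint) ^ (1 / 2 : ℝ) : H →L[ℂ] H) := CFC.rpow_nonneg
  have hT : IsBoundedInverse (modulus A) ((B * B.adjoint) ^ (1 / 2 : ℝ) : H →L[ℂ] H) :=
    isBoundedInverse_fracPow hBB hpos (by norm_num) (by norm_num)
  have hTT : ((B * B.adjoint) ^ (1 / 2 : ℝ) : H →L[ℂ] H) * (B * B.adjoint) ^ (1 / 2 : ℝ)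
      = B * B.adjoint := by
    rw [← CFC.sqrt_eq_rpow]; exact CFC.sqrt_mul_sqrt_self _
  generalize ((B * B.adjoint) ^ (1 / 2 : ℝ) : H →L[ℂ] H) = T at hT0 hT hTT
  have hTsa : IsSelfAdjoint T := IsSelfAdjoint.of_nonneg hT0
  have hTadj : T.adjoint = T := hTsa
  have hsq : ∀ {X : H →L[ℂ] H}, X.adjoint * X = B * B.adjoint → ∀ v,
      ‖X v‖ ^ 2 = RCLike.re ⟪(B * B.adjoint) v, v⟫_ℂ := fun {X} hX v => by
    rw [← hX, mul_apply_eq_comp, ContinuousLinearMap.adjoint_inner_left,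
      inner_self_eq_norm_sq_to_K]
    norm_cast
  -- Both squares equal `⟪B B† v, v⟫`; Douglas factorization in both directions then identifies the
  -- ranges of `T` and `B`.
  have hnorm : ∀ v, ‖T v‖ = ‖B.adjoint v‖ := fun v => by
    refine (sq_eq_sq₀ (norm_nonneg _) (norm_nonneg _)).mp ?_
    rw [hsq (X := T) (by rw [hTadj, hTT]),
      hsq (X := B.adjoint) (by rw [ContinuousLinearMap.adjoint_adjoint])]
  have hdT : DenseRange T := denseRange_of_injective_adjoint (by rw [hTadj]; exact hT.injective)
  have hdB : DenseRange B.adjoint := denseRange_of_injective_adjoint (by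
    rw [ContinuousLinearMap.adjoint_adjoint]; exact hB.injective)
  have hBT : ∀ w, ∃ w', B w = T w' ∧ ‖w'‖ ≤ ‖w‖ := fun w => by
    have := exists_adjoint_apply_eq hdT (fun v => (hnorm v).ge) w
    rwa [ContinuousLinearMap.adjoint_adjoint, hTadj] at this
  have hTB : ∀ w, ∃ w', T w = B w' ∧ ‖w'‖ ≤ ‖w‖ := fun w => by
    have := exists_adjoint_apply_eq hdB (fun v => (hnorm v).le) w
    rwa [ContinuousLinearMap.adjoint_adjoint, hTadj] at this
  refine ⟨T, hT, hT0, ?_, fun v => ?_, fun u => ?_⟩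
  · refine T.opNorm_le_bound zero_le_one fun v => ?_
    rw [hnorm]
    refine (B.adjoint.le_opNorm v).trans ?_
    rw [LinearIsometryEquiv.norm_map]
    gcongr
  · obtain ⟨w, hw, hwv⟩ := hTB v
    obtain ⟨v', hv', hvw⟩ := hBT w
    -- Injectivity closes the loop `‖w‖ ≤ ‖v‖ = ‖v'‖ ≤ ‖w‖`, where `w = A (T v)`.
    obtain rfl : v = v' := hT.injective (hw.trans hv')
    have hmem : T v ∈ A.domain := hw ▸ hB.mem_domain w
    have hval : A ⟨T v, hmem⟩ = w := by
      rw [← hB.apply_mk w (hB.mem_domain w)]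
      congr 1
      exact Subtype.ext hw
    exact ⟨hmem, by rw [hval]; exact le_antisymm hwv hvw⟩
  · obtain ⟨w, hw, -⟩ := hBT (A u)
    exact ⟨w, by rw [← hw, hB.2]⟩

/-- The inverse of a positive contraction is `≥ 1`. -/
lemma IsBoundedInverse.oneLE {Λ : H →ₗ.[ℂ] H} {T : H →L[ℂ] H} (hΛ : IsBoundedInverse Λ T)
    (hT : 0 ≤ T) (hT1 : ‖T‖ ≤ 1) : OneLE Λ := fun u => by
  set v := Λ u
  have hu : T v = u := hΛ.2 u
  -- With `v = Λ u`: `⟪u, Λ u⟫ = ‖S v‖²` while `‖u‖ = ‖S (S v)‖ ≤ ‖S v‖`.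
  let S : H →L[ℂ] H := CFC.sqrt T
  have hS : S * S = T := CFC.sqrt_mul_sqrt_self T
  have hSsa : IsSelfAdjoint S := IsSelfAdjoint.of_nonneg (CFC.sqrt_nonneg T)
  have hSS : ‖S‖ * ‖S‖ ≤ 1 := by
    rw [← sq, ← hSsa.norm_mul_self, hS]; exact hT1
  have hS1 : ‖S‖ ≤ 1 := by nlinarith [norm_nonneg S]
  have hTS : T v = S (S v) := by rw [← hS]; rfl
  have hinner : (⟪(u : H), v⟫_ℂ).re = ‖S v‖ ^ 2 := by
    have hsymm : ⟪S (S v), v⟫_ℂ = ⟪S v, S v⟫_ℂ := hSsa.isSymmetric _ _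
    rw [← hu, hTS, hsymm, inner_self_eq_norm_sq_to_K]
    norm_cast
  rw [hinner, ← hu, hTS]
  gcongr
  exact (S.le_opNorm _).trans (mul_le_of_le_one_left (norm_nonneg _) hS1)

/-! ### Pseudospectral operators are cuspidal -/

theorem IsPseudospectral.isCuspidal {K : H →ₗ.[ℂ] H} {r r' : ℝ} (hK : IsMaximalAccretive K)
    (h : IsPseudospectral K r) (h0 : 0 < r') (hr : r' ≤ r) :
    IsCuspidal K (modulus (shift 1 K)) r' := by
  have hr1 : r' ≤ 1 := hr.trans h.exponent_le_one
  have hd : Dense ((shift 1 K).domain : Set H) := hK.dense_domain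
  obtain ⟨B, hB, hB1⟩ := exists_isBoundedInverse (A := shift 1 K) zero_le_one
    (hK.surjective (by simp)) fun u => by rw [one_mul]; exact hK.norm_le 1 (by simp) u
  obtain ⟨T, hΛ, hT, hT1, hTK, hKT⟩ := hB.exists_modulus hd hB1
  have hdom : (modulus (shift 1 K)).domain = K.domain := by
    ext x
    constructor
    · intro hx
      rw [← show T (modulus (shift 1 K) ⟨x, hx⟩) = x from hΛ.2 ⟨x, hx⟩]
      exact (hTK _).1
    · intro hx
      obtain ⟨v, hv⟩ := hKT ⟨x, hx⟩
      rw [← show T v = x from hv]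
      exact hΛ.mem_domain v
  have hpow := isBoundedInverse_fracPow hΛ hT h0.le hr1
  have hmod : ∀ u : (modulus (shift 1 K)).domain, ∀ hu : (u : H) ∈ K.domain,
      ‖(1 : ℂ) • (u : H) + K ⟨u, hu⟩‖ = ‖modulus (shift 1 K) u‖ := fun u hu => by
    obtain ⟨h1, h2⟩ := hTK (modulus (shift 1 K) u)
    rw [← h2]
    have h3 : T (modulus (shift 1 K) u) = u := hΛ.2 u
    change _ = ‖(1 : ℂ) • T (modulus (shift 1 K) u) + K ⟨_, h1⟩‖
    congr 2
    · rw [h3]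
    · congr 1
      exact Subtype.ext h3.symm
  obtain ⟨C, hC, hCu⟩ := h.norm_le
  refine ⟨hΛ.isSelfAdjoint (IsSelfAdjoint.of_nonneg hT) (by rw [hdom]; exact hK.dense_domain),
    hΛ.oneLE hT hT1, h0, hr1, hdom.le, fun u ε hε => ⟨u, hdom.ge u.2, by simpa, by simpa⟩,
    2 * C + 2, by positivity, fun u => ?_, fun u => ?_⟩
  · have hu : (u : H) ∈ K.domain := hdom ▸ u.2
    have h1 := hmod u hu
    have h2 : ‖(u : H)‖ ≤ ‖modulus (shift 1 K) u‖ :=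
      (hK.norm_le 1 (by simp) ⟨u, hu⟩).trans h1.le
    have h3 : K ⟨u, hu⟩ = ((1 : ℂ) • (u : H) + K ⟨u, hu⟩) - u := by module
    calc ‖K ⟨u, hu⟩‖ ≤ ‖(1 : ℂ) • (u : H) + K ⟨u, hu⟩‖ + ‖(u : H)‖ := by
          conv_lhs => rw [h3]
          exact norm_sub_le _ _
      _ ≤ (2 * C + 2) * ‖modulus (shift 1 K) u‖ := by
          rw [h1]
          nlinarith [norm_nonneg (modulus (shift 1 K) u)]
  · have hu : (u : H) ∈ K.domain := hdom ▸ u.2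
    set v := modulus (shift 1 K) u with hv
    have hTv : T v = u := hΛ.2 u
    have hTpow := rpow_mul_rpow_one_sub hT h0.le hr1
    have hTw : (T ^ r' : H →L[ℂ] H) ((T ^ (1 - r') : H →L[ℂ] H) v) = u := by
      rw [← mul_apply_eq_comp, hTpow, hTv]
    have hw : (u : H) ∈ (fracPow (modulus (shift 1 K)) r').domain := by
      rw [← hTw]; exact hpow.mem_domain _
    refine ⟨⟨u, hw⟩, rfl, fun t => ?_⟩
    have hval : fracPow (modulus (shift 1 K)) r' ⟨u, hw⟩ = (T ^ (1 - r') : H →L[ℂ] H) v :=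
      hpow.injective ((hpow.2 ⟨u, hw⟩).trans hTw.symm)
    rw [hval]
    set s := √(1 + t ^ 2) with hs
    have hs1 : 1 ≤ s := one_le_sqrt_one_add_sq t
    have hs0 : 0 < s := by positivity
    set f := (1 - Complex.I * t) • (u : H) + K ⟨u, hu⟩ with hf
    have huf : ‖(u : H)‖ ≤ C * s ^ (-r) * ‖f‖ := hCu t ⟨u, hu⟩
    have hss : s * s ^ (-r) = s ^ (1 - r) := by
      rw [sub_eq_add_neg, Real.rpow_add hs0, Real.rpow_one]
    -- `‖v‖ = ‖(1 + K) u‖` and `(1 + K) u = f + i t u` with `|t| ≤ s`.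
    have hvf : ‖v‖ ≤ (1 + C) * s ^ (1 - r) * ‖f‖ := by
      have h1 : (1 : ℂ) • (u : H) + K ⟨u, hu⟩ = f + (Complex.I * t) • (u : H) := by
        rw [hf]; module
      have h2 : ‖(Complex.I * t : ℂ)‖ ≤ s := by
        rw [norm_mul, Complex.norm_I, one_mul, Complex.norm_real]
        exact Real.abs_le_sqrt (by linarith)
      have h3 : 1 ≤ s ^ (1 - r) :=
        Real.one_le_rpow hs1 (sub_nonneg.mpr h.exponent_le_one)
      calc ‖v‖ = ‖f + (Complex.I * t) • (u : H)‖ := by rw [← h1]; exact (hmod u hu).symm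
        _ ≤ ‖f‖ + s * (C * s ^ (-r) * ‖f‖) := by
            refine (norm_add_le _ _).trans ?_
            rw [norm_smul]
            gcongr
        _ = 1 * ‖f‖ + C * s ^ (1 - r) * ‖f‖ := by rw [← hss]; ring
        _ ≤ s ^ (1 - r) * ‖f‖ + C * s ^ (1 - r) * ‖f‖ := by gcongr
        _ = _ := by ring
    obtain ⟨P, G, -, hPG, hP, hG⟩ := exists_rpow_eq_add_mul hT (sub_nonneg.mpr hr1)
      (sub_le_self 1 h0.le) hs0
    -- The order `G T` matters: `T v = u` lets the better bound on `u` be used.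
    have hsplit : (T ^ (1 - r') : H →L[ℂ] H) v = P v + G u := by
      rw [hPG, ← hTv]; rfl
    have he1 : s ^ (-(1 - r')) * s ^ (1 - r) = s ^ (r' - r) := by
      rw [← Real.rpow_add hs0]; congr 1; ring
    have he2 : s ^ (1 - (1 - r')) * s ^ (-r) = s ^ (r' - r) := by
      rw [← Real.rpow_add hs0]; congr 1; ring
    have he3 : s ^ (r' - r) ≤ 1 := Real.rpow_le_one_of_one_le_of_nonpos hs1 (by linarith)
    have hfin : ‖f‖ ≤ ‖K ⟨u, hu⟩ - (Complex.I * t) • (u : H)‖ + ‖(u : H)‖ := by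
      rw [show f = (K ⟨u, hu⟩ - (Complex.I * t) • (u : H)) + u by rw [hf]; module]
      exact norm_add_le _ _
    calc ‖(T ^ (1 - r') : H →L[ℂ] H) v‖
        ≤ s ^ (-(1 - r')) * ((1 + C) * s ^ (1 - r) * ‖f‖) +
          s ^ (1 - (1 - r')) * (C * s ^ (-r) * ‖f‖) := by
          rw [hsplit]
          refine (norm_add_le _ _).trans (add_le_add ?_ ?_)
          · exact (P.le_opNorm v).trans (by gcongr)
          · exact (G.le_opNorm u).trans (by gcongr)
      _ = (1 + C) * (s ^ (-(1 - r')) * s ^ (1 - r)) * ‖f‖ +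
          C * (s ^ (1 - (1 - r')) * s ^ (-r)) * ‖f‖ := by ring
      _ = (2 * C + 1) * s ^ (r' - r) * ‖f‖ := by rw [he1, he2]; ring
      _ ≤ (2 * C + 2) * 1 * ‖f‖ := by gcongr; norm_num
      _ = (2 * C + 2) * ‖f‖ := by ring
      _ ≤ _ := by gcongr

end Modulus

end Cuspidal

theorem theorem3p5 {H : Type*} [NormedAddCommGroup H] [InnerProductSpace ℂ H] [CompleteSpace H]
    (K : H →ₗ.[ℂ] H) (hK : Cuspidal.IsMaximalAccretive K) (r : ℝ) :
    (∀ Λ : H →ₗ.[ℂ] H, Cuspidal.IsCuspidal K Λ r → Cuspidal.IsPseudospectral K r) ∧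
    (Cuspidal.IsPseudospectral K r → ∀ r' : ℝ, 0 < r' → r' < r / (2 - r) →
      Cuspidal.IsCuspidal K (Cuspidal.modulus (Cuspidal.shift 1 K)) r') := by
  -- Since `2 - r ≥ 1`, `r / (2 - r) ≤ r`: the stated range lies inside `r' ≤ r`.
  refine ⟨fun Λ h => h.isPseudospectral hK, fun h r' h0 hr => h.isCuspidal hK h0 (hr.le.trans ?_)⟩
  rw [div_le_iff₀ (by linarith [h.exponent_le_one])]
  nlinarith [h.exponent_pos, h.exponent_le_one]
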